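/- Let $\mathcal S=\{(a,b)\in\mathbb R^2:0\le a\le b\le 1\}$, where the point $(a,b)$ is identified with the closed interval $[a,b]$, and let $W(I,J)=1$ if $I\cap J\ne\emptyset$ and $W(I,J)=0$ otherwise, for $I,J\in\mathcal S$. For finite simple graphs $F,G$ let $t(F,G)$ be the probability that a uniformly random map $V(F)\to V(G)$ is a graph homomorphism. A graph limit $\Gamma$ is given by a family of numbers $(t(F,\Gamma))_F$, indexed by all finite graphs $F$, for which there is a sequence of finite graphs $G_m$ with $|G_m|\to\infty$ and $t(F,G_m)\to t(F,\Gamma)$ for every $F$; in this case we write $G_m\to\Gamma$. For a Borel probability measure $\mu$ on $\mathcal S$, $\Gamma_\mu$ denotes the graph limit with $$t(F,\Gamma_\mu)=\int_{\mathcal S^{k}}\prod_{ij\in E(F)}W(x_i,x_j)\,d\mu(x_1)\cdots d\mu(x_{k})$$ for every finite graph $F$ with vertices $1,\dots,k$. A unit interval graph is a graph $G$ for which there are real numbers $x_v$, $v\in V(G)$, such that distinct vertices $v,w$ are adjacent if and only if $[x_v,x_v+1]\cap[x_w,x_w+1]\neq\emptyset$. A graph limit $\Gamma$ is a unit interval graph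 limit if $G_m\to\Gamma$ for some sequence $(G_m)$ of finite unit interval graphs. Theorem. A graph limit $\Gamma$ is a unit interval graph limit if and only if $\Gamma=\Gamma_\mu$ for some Borel probability measure $\mu$ on $\mathcal S$ whose support is contained in the image of some continuous curve $\gamma=(\gamma_1,\gamma_2):[0,1]\to\mathcal S$ such that both $\gamma_1$ and $\gamma_2$ are weakly increasing. -/

import Mathlib

open MeasureTheory ProbabilityTheory Filter Topology

noncomputable section

namespace IntervalGraphLimits

/-! ### Finite graphs, homomorphism densities and graph limits -/

/-- A finite (simple) graph, with vertex set `{0, …, n - 1}`. -/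
abbrev FinGraph : Type := Σ n : ℕ, SimpleGraph (Fin n)

/-- `t(F, G)`: the probability that a uniformly random map `V(F) → V(G)` is a graph homomorphism,
i.e. the number of homomorphisms `F → G` divided by `|G| ^ |F|`. -/
def homDensity {k n : ℕ} (F : SimpleGraph (Fin k)) (G : SimpleGraph (Fin n)) : ℝ :=
  (Nat.card (F →g G) : ℝ) / (n : ℝ) ^ k

/-- The number of vertices of `G m` tends to infinity and, for every graph `F`,
`t(F, G m)` tends to `τ(F)`. -/
def HomConverges (G : ℕ → FinGraph) (τ : (k : ℕ) → SimpleGraph (Fin k) → ℝ) : Prop :=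
  Tendsto (fun m => (G m).1) atTop atTop ∧
    ∀ (k : ℕ) (F : SimpleGraph (Fin k)),
      Tendsto (fun m => homDensity F (G m).2) atTop (𝓝 (τ k F))

/-- A (proper) graph limit `Γ`. It is determined by the numbers `t(F, Γ)`, `F` a finite graph, and
the families of numbers that occur are the limits of `t(F, G m)` along sequences of graphs `G m`
with `|G m| → ∞`. -/
@[ext]
structure GraphLimit where
  /-- The number `t(F, Γ)`. -/
  t : (k : ℕ) → SimpleGraph (Fin k) → ℝ
  exists_seq : ∃ G : ℕ → FinGraph, HomConverges G t

/-- `G` is a unit interval graph: there are real numbers `x v` such that distinct vertices `v`, `w`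
are adjacent if and only if the closed unit intervals `[x v, x v + 1]` and `[x w, x w + 1]`
intersect. -/
def IsUnitIntervalGraph {V : Type*} (G : SimpleGraph V) : Prop :=
  ∃ x : V → ℝ, ∀ v w : V, v ≠ w →
    (G.Adj v w ↔ (Set.Icc (x v) (x v + 1) ∩ Set.Icc (x w) (x w + 1)).Nonempty)

/-- A graph limit is a unit interval graph limit if it is the limit of some sequence of unit
interval graphs (with number of vertices tending to infinity). -/
def GraphLimit.IsUnitIntervalGraphLimit (Γ : GraphLimit) : Prop :=
  ∃ G : ℕ → FinGraph, (∀ m, IsUnitIntervalGraph (G m).2) ∧ HomConverges G Γ.t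

/-! ### The triangle of closed subintervals of `[0, 1]`, and the graph limit of a measure on it -/

/-- The triangle `S = {(a, b) : 0 ≤ a ≤ b ≤ 1}`, whose points are the non-empty closed
subintervals `[a, b]` of `[0, 1]`; it carries the topology and the Borel `σ`-algebra of `ℝ × ℝ`. -/
abbrev Triangle : Type := {p : ℝ × ℝ // 0 ≤ p.1 ∧ p.1 ≤ p.2 ∧ p.2 ≤ 1}

/-- The intervals `I = [a, b]` and `J = [a', b']` intersect. -/
def Meets (I J : Triangle) : Prop :=
  (Set.Icc I.1.1 I.1.2 ∩ Set.Icc J.1.1 J.1.2).Nonempty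

open Classical in
/-- The kernel `W(I, J) = 1` if `I ∩ J ≠ ∅`, and `W(I, J) = 0` otherwise. -/
def kernelW (I J : Triangle) : ℝ := if Meets I J then 1 else 0

open Classical in
/-- `t(F, μ) = ∫ ∏_{ij ∈ E(F)} W(x_i, x_j) dμ(x_1) ⋯ dμ(x_k)` for a graph `F` with `k` vertices. -/
def measureDensity (μ : ProbabilityMeasure Triangle) (k : ℕ) (F : SimpleGraph (Fin k)) : ℝ :=
  ∫ x : Fin k → Triangle,
    ∏ e : Fin k × Fin k with e.1 < e.2 ∧ F.Adj e.1 e.2, kernelW (x e.1) (x e.2)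
    ∂(Measure.pi fun _ => (μ : Measure Triangle))

/-! The following facts show that `t(·, μ)` is a graph limit. -/

lemma meets_iff (I J : Triangle) : Meets I J ↔ I.1.1 ≤ J.1.2 ∧ J.1.1 ≤ I.1.2 := by
  obtain ⟨⟨a, b⟩, h1, h2, h3⟩ := I
  obtain ⟨⟨c, d⟩, h4, h5, h6⟩ := J
  simp only [Meets, Set.Icc_inter_Icc, Set.nonempty_Icc, sup_le_iff, le_inf_iff] at *
  tauto

lemma meets_comm (I J : Triangle) : Meets I J ↔ Meets J I := by
  rw [meets_iff, meets_iff, and_comm]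

/-- The set of `y` such that `y i` and `y j` intersect for all edges `ij` of `F`. -/
def homSet {ι : Type*} (F : SimpleGraph ι) : Set (ι → Triangle) :=
  {y | ∀ i j, F.Adj i j → Meets (y i) (y j)}

lemma measurableSet_homSet {ι : Type*} [Finite ι] (F : SimpleGraph ι) :
    MeasurableSet (homSet F) := by
  have : homSet F = ⋂ i, ⋂ j, {y | F.Adj i j → Meets (y i) (y j)} := by
    ext y; simp [homSet]
  rw [this]
  refine MeasurableSet.iInter fun i => MeasurableSet.iInter fun j => ?_
  by_cases h : F.Adj i j
  · simp only [h, forall_const, meets_iff, Set.ofPred_and]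
    refine MeasurableSet.inter ?_ ?_
    · exact measurableSet_le (by fun_prop) (by fun_prop)
    · exact measurableSet_le (by fun_prop) (by fun_prop)
  · simp [h]

lemma measureDensity_eq (μ : ProbabilityMeasure Triangle) (k : ℕ) (F : SimpleGraph (Fin k)) :
    measureDensity μ k F =
      ∫ x, (homSet F).indicator (fun _ => (1 : ℝ)) x
        ∂(Measure.pi fun _ => (μ : Measure Triangle)) := by
  classical
  unfold measureDensity
  congr 1
  ext x
  simp only [kernelW, Set.indicator, homSet, Set.mem_ofPred_eq, Finset.prod_boole]
  congr 1
  simp only [Finset.mem_filter, Finset.mem_univ, true_and, Prod.forall, eq_iff_iff]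
  refine ⟨fun h i j hij => ?_, fun h i j hij => h i j hij.2⟩
  rcases lt_trichotomy i j with hl | hl | hl
  · exact h i j ⟨hl, hij⟩
  · exact absurd hl hij.ne
  · exact (meets_comm _ _).1 (h j i ⟨hl, hij.symm⟩)

/-- The intersection graph of a family of intervals. -/
def meetGraph {n : ℕ} (x : Fin n → Triangle) : SimpleGraph (Fin n) where
  Adj i j := i ≠ j ∧ Meets (x i) (x j)
  symm := ⟨fun _ _ h => ⟨h.1.symm, (meets_comm _ _).1 h.2⟩⟩
  loopless := ⟨fun _ h => h.1 rfl⟩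

/-- The set of `x` for which `φ` is a homomorphism from `F` to the intersection graph of `x`. -/
def homEvent {k n : ℕ} (F : SimpleGraph (Fin k)) (φ : Fin k → Fin n) :
    Set (Fin n → Triangle) :=
  {x | ∀ i j, F.Adj i j → (meetGraph x).Adj (φ i) (φ j)}

lemma measurableSet_homEvent {k n : ℕ} (F : SimpleGraph (Fin k)) (φ : Fin k → Fin n) :
    MeasurableSet (homEvent F φ) := by
  have : homEvent F φ = {x | ∀ i j, F.Adj i j → φ i ≠ φ j} ∩
      (fun x : Fin n → Triangle => fun i => x (φ i)) ⁻¹' homSet F := by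
    ext x
    simp only [homEvent, meetGraph, homSet, Set.mem_ofPred_eq, Set.mem_inter_iff, Set.mem_preimage]
    exact ⟨fun h => ⟨fun i j e => (h i j e).1, fun i j e => (h i j e).2⟩,
      fun h i j e => ⟨h.1 i j e, h.2 i j e⟩⟩
  rw [this]
  exact (MeasurableSet.const _).inter ((measurableSet_homSet F).preimage (by fun_prop))

lemma homEvent_of_injective {k n : ℕ} (F : SimpleGraph (Fin k)) {φ : Fin k → Fin n}
    (hφ : Function.Injective φ) :
    homEvent F φ = (fun x : Fin n → Triangle => fun i => x (φ i)) ⁻¹' homSet F := by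
  ext x
  simp only [homEvent, meetGraph, homSet, Set.mem_ofPred_eq, Set.mem_preimage]
  exact ⟨fun h i j e => (h i j e).2, fun h i j e => ⟨fun h' => e.ne (hφ h'), h i j e⟩⟩

lemma homDensity_meetGraph {k n : ℕ} (F : SimpleGraph (Fin k)) (x : Fin n → Triangle) :
    homDensity F (meetGraph x) =
      (∑ φ : Fin k → Fin n, (homEvent F φ).indicator (fun _ => (1 : ℝ)) x) / (n : ℝ) ^ k := by
  classical
  unfold homDensity
  congr 1
  have e : (F →g meetGraph x) ≃ {φ : Fin k → Fin n // x ∈ homEvent F φ} :=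
    { toFun := fun f => ⟨f, fun i j h => f.map_adj h⟩
      invFun := fun f => ⟨f.1, fun {i j} h => f.2 i j h⟩
      left_inv := fun f => rfl
      right_inv := fun f => rfl }
  rw [Nat.card_congr e, Nat.card_eq_fintype_card, Fintype.card_subtype]
  simp [Set.indicator]

/-- The proportion of non-injective maps from a `k`-set to an `n`-set. -/
def nonInj (k n : ℕ) : ℝ := 1 - (n.descFactorial k : ℝ) / (n : ℝ) ^ k

lemma tendsto_nonInj (k : ℕ) : Tendsto (nonInj k) atTop (𝓝 0) := by
  have h := isEquivalent_descFactorial k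
  have h2 : Tendsto (fun n : ℕ => (n.descFactorial k : ℝ) / (n : ℝ) ^ k) atTop (𝓝 1) := by
    refine (Asymptotics.isEquivalent_iff_tendsto_one ?_).1 h
    filter_upwards [eventually_gt_atTop 0] with n hn
    positivity
  have h3 := h2.const_sub 1
  rw [sub_self] at h3
  exact h3

lemma avg_close {ι : Type*} [Fintype ι] [DecidableEq ι] {n : ℕ} (hn : 0 < n)
    (c : (ι → Fin n) → ℝ) {t : ℝ}
    (hc0 : ∀ φ, 0 ≤ c φ) (hc1 : ∀ φ, c φ ≤ 1) (ht0 : 0 ≤ t) (ht1 : t ≤ 1)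
    (hc : ∀ φ, Function.Injective φ → c φ = t) :
    |(∑ φ, c φ) / (n : ℝ) ^ Fintype.card ι - t| ≤ nonInj (Fintype.card ι) n := by
  classical
  have hpos : (0 : ℝ) < (n : ℝ) ^ Fintype.card ι := by positivity
  have hcard : (Fintype.card (ι → Fin n) : ℝ) = (n : ℝ) ^ Fintype.card ι := by simp
  have hinj : ((Finset.univ.filter fun φ : ι → Fin n => Function.Injective φ).card : ℝ) =
      (n.descFactorial (Fintype.card ι) : ℝ) := by
    rw [← Fintype.card_subtype, Fintype.card_congr (Equiv.subtypeInjectiveEquivEmbedding ι (Fin n)),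
      Fintype.card_embedding_eq, Fintype.card_fin]
  have h1 : (∑ φ, c φ) / (n : ℝ) ^ Fintype.card ι - t =
      (∑ φ, (c φ - t)) / (n : ℝ) ^ Fintype.card ι := by
    rw [Finset.sum_sub_distrib, Finset.sum_const, Finset.card_univ, nsmul_eq_mul, hcard]
    field_simp
  have h2 : nonInj (Fintype.card ι) n =
      (∑ φ : ι → Fin n, (1 - if Function.Injective φ then (1 : ℝ) else 0)) /
        (n : ℝ) ^ Fintype.card ι := by
    rw [Finset.sum_sub_distrib, Finset.sum_const, Finset.card_univ, nsmul_eq_mul, hcard,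
      Finset.sum_boole, hinj, nonInj]
    field_simp
  rw [h1, h2, abs_div, abs_of_pos hpos]
  gcongr
  refine (Finset.abs_sum_le_sum_abs _ _).trans (Finset.sum_le_sum fun φ _ => ?_)
  by_cases h : Function.Injective φ
  · simp [h, hc φ h]
  · simp only [h, if_false, sub_zero, abs_le]
    constructor <;> linarith [hc0 φ, hc1 φ]

lemma map_comp_injective {ι κ : Type*} [Fintype ι] [Fintype κ] (μ : Measure Triangle)
    [IsProbabilityMeasure μ] {φ : ι → κ} (hφ : Function.Injective φ) :
    MeasurePreserving (fun x : κ → Triangle => fun i => x (φ i))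
      (Measure.pi fun _ => μ) (Measure.pi fun _ => μ) := by
  refine ⟨by fun_prop, ?_⟩
  have h := iIndepFun_pi (μ := fun _ : κ => μ) (X := fun _ => id) (fun _ => aemeasurable_id)
  have h2 := h.precomp hφ
  have h3 := (iIndepFun_iff_map_fun_eq_pi_map (β := fun _ : ι => Triangle)
    (f := fun (i : ι) (ω : κ → Triangle) => ω (φ i))
    (fun i => (measurable_pi_apply (φ i)).aemeasurable)).1 h2
  rw [h3]
  congr 1
  ext1 i
  exact (measurePreserving_eval (fun _ : κ => μ) (φ i)).map_eq

lemma integrable_ind {Ω : Type*} [MeasurableSpace Ω] (P : Measure Ω) [IsProbabilityMeasure P]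
    {A : Set Ω} (hA : MeasurableSet A) : Integrable (A.indicator fun _ => (1 : ℝ)) P :=
  (integrable_const 1).indicator hA

lemma integral_ind_nonneg {Ω : Type*} [MeasurableSpace Ω] (P : Measure Ω) (A : Set Ω) :
    0 ≤ ∫ x, A.indicator (fun _ => (1 : ℝ)) x ∂P :=
  integral_nonneg fun x => Set.indicator_nonneg (fun _ _ => zero_le_one) x

lemma integral_ind_le_one {Ω : Type*} [MeasurableSpace Ω] (P : Measure Ω) [IsProbabilityMeasure P]
    {A : Set Ω} (hA : MeasurableSet A) : ∫ x, A.indicator (fun _ => (1 : ℝ)) x ∂P ≤ 1 := by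
  rw [integral_indicator_const _ hA]
  simp [measureReal_le_one]

lemma second_moment (μ : ProbabilityMeasure Triangle) {k n : ℕ} (hn : 0 < n)
    (F : SimpleGraph (Fin k)) :
    Integrable (fun x : Fin n → Triangle =>
        (homDensity F (meetGraph x) - measureDensity μ k F) ^ 2)
      (Measure.pi fun _ => (μ : Measure Triangle)) ∧
    ∫ x : Fin n → Triangle, (homDensity F (meetGraph x) - measureDensity μ k F) ^ 2
      ∂(Measure.pi fun _ => (μ : Measure Triangle)) ≤ nonInj (k + k) n + 2 * nonInj k n := by
  classical
  set P : Measure (Fin n → Triangle) := Measure.pi fun _ => (μ : Measure Triangle) with hP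
  set t := measureDensity μ k F with ht
  have ht' := measureDensity_eq μ k F
  rw [← ht] at ht'
  have ht0 : 0 ≤ t := by rw [ht']; exact integral_ind_nonneg _ _
  have ht1 : t ≤ 1 := by rw [ht']; exact integral_ind_le_one _ (measurableSet_homSet F)
  set a : (Fin k → Fin n) → (Fin n → Triangle) → ℝ :=
    fun φ => (homEvent F φ).indicator (fun _ => (1 : ℝ)) with ha
  have hmeas := fun φ : Fin k → Fin n => measurableSet_homEvent F φ
  have hint : ∀ φ, Integrable (a φ) P := fun φ => integrable_ind P (hmeas φ)
  have hmul : ∀ φ ψ x, a φ x * a ψ x =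
      (homEvent F φ ∩ homEvent F ψ).indicator (fun _ => (1 : ℝ)) x := by
    intro φ ψ x
    by_cases h1 : x ∈ homEvent F φ <;> by_cases h2 : x ∈ homEvent F ψ <;> simp [ha, h1, h2]
  have hint2 : ∀ φ ψ, Integrable (fun x => a φ x * a ψ x) P := by
    intro φ ψ
    simp only [hmul]
    exact integrable_ind P ((hmeas φ).inter (hmeas ψ))
  have hV : ∀ x, homDensity F (meetGraph x) = (∑ φ, a φ x) / (n : ℝ) ^ k :=
    fun x => homDensity_meetGraph F x
  -- first moment
  have hVint : Integrable (fun x => homDensity F (meetGraph x)) P := by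
    simp only [hV]
    exact (integrable_finsetSum _ fun φ _ => hint φ).div_const _
  have h1 : |(∫ x, homDensity F (meetGraph x) ∂P) - t| ≤ nonInj k n := by
    have := avg_close hn (fun φ : Fin k → Fin n => ∫ x, a φ x ∂P) (t := t)
      (fun φ => integral_ind_nonneg _ _) (fun φ => integral_ind_le_one _ (hmeas φ)) ht0 ht1 (by
        intro φ hφ
        have hmp := map_comp_injective (μ : Measure Triangle) hφ
        rw [ht', ← hmp.map_eq, integral_map hmp.measurable.aemeasurable
          (by rw [hmp.map_eq]; exact (integrable_ind _ (measurableSet_homSet F)).aestronglyMeasurable)]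
        simp only [ha, homEvent_of_injective F hφ]
        rfl)
    simp only [hV]
    rw [integral_div, integral_finsetSum _ fun φ _ => hint φ]
    simpa using this
  -- second moment
  have hV2 : ∀ x, homDensity F (meetGraph x) ^ 2 =
      (∑ p : Fin k ⊕ Fin k → Fin n, a (fun i => p (.inl i)) x * a (fun i => p (.inr i)) x) /
        (n : ℝ) ^ (k + k) := by
    intro x
    rw [hV, div_pow, sq, Finset.sum_mul_sum, ← pow_mul, mul_two, ← Fintype.sum_prod_type',
      ← Equiv.sum_comp (Equiv.sumArrowEquivProdArrow (Fin k) (Fin k) (Fin n))]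
    rfl
  have hV2int : Integrable (fun x => homDensity F (meetGraph x) ^ 2) P := by
    simp only [hV2]
    exact (integrable_finsetSum _ fun p _ => hint2 _ _).div_const _
  have h2 : |(∫ x, homDensity F (meetGraph x) ^ 2 ∂P) - t ^ 2| ≤ nonInj (k + k) n := by
    have := avg_close hn (fun p : Fin k ⊕ Fin k → Fin n =>
        ∫ x, a (fun i => p (.inl i)) x * a (fun i => p (.inr i)) x ∂P) (t := t ^ 2)
      (fun p => by simp only [hmul]; exact integral_ind_nonneg _ _)
      (fun p => by simp only [hmul]; exact integral_ind_le_one _ ((hmeas _).inter (hmeas _)))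
      (by positivity) (by nlinarith) (by
        intro p hp
        have hmp := map_comp_injective (μ : Measure Triangle) hp
        have hmq := measurePreserving_sumPiEquivProdPi
          (fun _ : Fin k ⊕ Fin k => (μ : Measure Triangle))
        have hl : Function.Injective fun i => p (.inl i) := hp.comp Sum.inl_injective
        have hr : Function.Injective fun i => p (.inr i) := hp.comp Sum.inr_injective
        have hq := hmq.comp hmp
        have hms := (integrable_ind (Measure.pi fun _ : Fin k => (μ : Measure Triangle))
          (measurableSet_homSet F))
        rw [sq, ht', ← integral_prod_mul, ← hq.map_eq,
          integral_map hq.measurable.aemeasurable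
            (by rw [hq.map_eq]; exact (hms.mul_prod hms).aestronglyMeasurable)]
        simp only [ha, homEvent_of_injective F hl, homEvent_of_injective F hr]
        rfl)
    simp only [hV2]
    rw [integral_div, integral_finsetSum _ fun p _ => hint2 _ _]
    simpa using this
  have hexp : ∀ x : Fin n → Triangle, (homDensity F (meetGraph x) - t) ^ 2 =
      homDensity F (meetGraph x) ^ 2 - (2 * t) * homDensity F (meetGraph x) + t ^ 2 := by
    intro x; ring
  simp only [hexp]
  have hi1 : Integrable (fun x => homDensity F (meetGraph x) ^ 2 -
      2 * t * homDensity F (meetGraph x)) P := hV2int.sub (hVint.const_mul (2 * t))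
  refine ⟨hi1.add (integrable_const _), ?_⟩
  rw [integral_add hi1 (integrable_const _), integral_sub hV2int (hVint.const_mul (2 * t)),
    integral_const_mul]
  simp only [integral_const, probReal_univ, one_smul]
  have := abs_le.1 h1
  have := abs_le.1 h2
  nlinarith

/-- There are graphs `G m` with `|G m| → ∞` and `t(F, G m) → t(F, μ)` for every `F`. -/
lemma exists_seq_measureDensity (μ : ProbabilityMeasure Triangle) :
    ∃ G : ℕ → FinGraph, HomConverges G (measureDensity μ) := by
  classical
  have key : ∀ m : ℕ, ∃ n : ℕ, m ≤ n ∧ ∃ x : Fin n → Triangle,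
      ∀ k ≤ m, ∀ F : SimpleGraph (Fin k),
        (homDensity F (meetGraph x) - measureDensity μ k F) ^ 2 ≤ 1 / ((m : ℝ) + 1) := by
    intro m
    have hlim : Tendsto (fun n : ℕ => ∑ k ∈ Finset.range (m + 1),
        ∑ _F : SimpleGraph (Fin k), (nonInj (k + k) n + 2 * nonInj k n)) atTop (𝓝 0) := by
      have : (0 : ℝ) = ∑ k ∈ Finset.range (m + 1),
          ∑ _F : SimpleGraph (Fin k), ((0 : ℝ) + 2 * 0) := by simp
      rw [this]
      exact tendsto_finsetSum _ fun k _ => tendsto_finsetSum _ fun F _ =>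
        (tendsto_nonInj _).add ((tendsto_nonInj _).const_mul 2)
    have hev := hlim.eventually (ge_mem_nhds (show (0 : ℝ) < 1 / ((m : ℝ) + 1) by positivity))
    obtain ⟨n, hn, hmn, hn0⟩ :=
      (hev.and ((eventually_ge_atTop m).and (eventually_gt_atTop 0))).exists
    refine ⟨n, hmn, ?_⟩
    have hsm := fun (k : ℕ) (F : SimpleGraph (Fin k)) => second_moment μ hn0 F
    have hI : Integrable (fun x : Fin n → Triangle => ∑ k ∈ Finset.range (m + 1),
        ∑ F : SimpleGraph (Fin k), (homDensity F (meetGraph x) - measureDensity μ k F) ^ 2)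
        (Measure.pi fun _ => (μ : Measure Triangle)) :=
      integrable_finsetSum _ fun k _ => integrable_finsetSum _ fun F _ => (hsm k F).1
    obtain ⟨x, hx⟩ := exists_le_integral hI
    rw [integral_finsetSum _ fun k _ => integrable_finsetSum _ fun F _ => (hsm k F).1] at hx
    simp only [integral_finsetSum _ fun F _ => (hsm _ F).1] at hx
    have hx2 := hx.trans ((Finset.sum_le_sum fun k _ => Finset.sum_le_sum fun F _ =>
      (hsm k F).2).trans hn)
    refine ⟨x, fun k hk F => le_trans ?_ hx2⟩
    refine le_trans ?_ (Finset.single_le_sum (f := fun k => ∑ F : SimpleGraph (Fin k),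
      (homDensity F (meetGraph x) - measureDensity μ k F) ^ 2)
      (fun k _ => Finset.sum_nonneg fun F _ => sq_nonneg _)
      (Finset.mem_range.2 (Nat.lt_succ_of_le hk)))
    exact Finset.single_le_sum (f := fun F : SimpleGraph (Fin k) =>
      (homDensity F (meetGraph x) - measureDensity μ k F) ^ 2)
      (fun F _ => sq_nonneg _) (Finset.mem_univ F)
  choose n hn x hx using key
  refine ⟨fun m => ⟨n m, meetGraph (x m)⟩, tendsto_atTop_mono hn tendsto_id, fun k F => ?_⟩
  rw [← tendsto_sub_nhds_zero_iff]
  have hsq : Tendsto (fun m => (homDensity F (meetGraph (x m)) - measureDensity μ k F) ^ 2)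
      atTop (𝓝 0) := by
    refine tendsto_of_tendsto_of_tendsto_of_le_of_le' tendsto_const_nhds
      tendsto_one_div_add_atTop_nhds_zero_nat (Eventually.of_forall fun m => sq_nonneg _) ?_
    filter_upwards [eventually_ge_atTop k] with m hm using hx m k hm F
  have := hsq.sqrt
  simp only [Real.sqrt_sq_eq_abs, Real.sqrt_zero] at this
  exact (tendsto_zero_iff_abs_tendsto_zero _).2 this

/-- The graph limit `Γ_μ` defined by a probability measure `μ` on the triangle `S`. -/
def GraphLimit.ofMeasure (μ : ProbabilityMeasure Triangle) : GraphLimit where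
  t := measureDensity μ
  exists_seq := exists_seq_measureDensity μ

/-- The support of `μ` lies on some curve `γ = (γ₁, γ₂)` in the triangle `S`, with `γ₁` and `γ₂`
both weakly increasing. -/
def HasIncreasingCurveSupport (μ : ProbabilityMeasure Triangle) : Prop :=
  ∃ γ : unitInterval → Triangle, Continuous γ ∧
    Monotone (fun s => (γ s).1.1) ∧ Monotone (fun s => (γ s).1.2) ∧
    (μ : Measure Triangle).support ⊆ Set.range γ

end IntervalGraphLimits

end

noncomputable section

namespace IntervalGraphLimits

/-! ### Intersection graphs of chains of intervals -/

/-! The link between the two sides is order. For intervals sorted so that both endpoints increase,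
two of them with `i < j` meet exactly when `a j ≤ b i`, so the intersection graph is determined by
how far to the right each vertex reaches, and this reach is monotone. Unit interval graphs have the
same structure.

From measure to graphs: points on an increasing curve are pairwise comparable in the product order,
so a finite sample from `μ` can be sorted into a chain. A chain can be replaced by unit intervals
placed one after another (`exists_unit_placement`), hence sampled graphs are unit interval graphs. A
second moment bound gives samples that converge to `Γ_μ` (`exists_sample_homConverges`).

From graphs to measure: with the vertices sorted by position and spread over `[0, 1]`, each graph is
encoded by a monotone reach function (`IsUnitIntervalGraph.exists_step_representation`). Helly
selection gives a subsequence of these functions converging to a monotone `r`, and `μ` is the law of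
`[u, r u]` for uniform `u`. Dominated convergence identifies the limiting densities
(`tendsto_homDensity_of_step`). Filling in the jumps of `r` by vertical segments gives the
continuous increasing curve (`exists_increasing_curve`). -/

/-- A strictly increasing placement of points on the line such that two of them are at distance
less than one exactly when the corresponding intervals `[a i, b i]` intersect. -/
lemma exists_unit_placement {a b : ℕ → ℝ} (ha : Monotone a) (hb : Monotone b) (n : ℕ) :
    ∃ z : ℕ → ℝ, ∀ i j, i < j → j < n →
      z i < z j ∧ (a j ≤ b i → z j < z i + 1) ∧ (b i < a j → z i + 1 < z j) := by
  classical
  induction n with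
  | zero => exact ⟨0, fun i j _ h => absurd h (Nat.not_lt_zero j)⟩
  | succ n ih =>
    obtain ⟨z, hz⟩ := ih
    -- The new point must exceed every earlier `z i`, exceed `z i + 1` when interval `i` ends before
    -- the new one starts, and stay below `z i + 1` otherwise. These finitely many strict bounds are
    -- compatible, so density of the line supplies `w`.
    obtain ⟨w, hlo, hhi⟩ := Order.exists_between_finsets
      (lo := (Finset.range n).image z ∪
        ((Finset.range n).filter fun i => b i < a n).image fun i => z i + 1)
      (hi := ((Finset.range n).filter fun i => a n ≤ b i).image fun i => z i + 1) (by
        intro x hx y hy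
        simp only [Finset.mem_union, Finset.mem_image, Finset.mem_filter, Finset.mem_range]
          at hx hy
        obtain ⟨j, ⟨hjn, hj⟩, rfl⟩ := hy
        rcases hx with ⟨i, hin, rfl⟩ | ⟨i, ⟨hin, hi⟩, rfl⟩
        · rcases lt_trichotomy i j with h | rfl | h
          · linarith [(hz i j h hjn).1]
          · linarith
          · exact (hz j i h hin).2.1 ((ha hin.le).trans hj)
        -- Here `b i < a n ≤ b j`, so monotonicity of `b` forces `i < j`.
        · have hij : i < j := hb.reflect_lt (hi.trans_le hj)
          linarith [(hz i j hij hjn).1])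
    simp only [Finset.mem_union, Finset.mem_image, Finset.mem_filter, Finset.mem_range] at hlo hhi
    refine ⟨fun i => if i < n then z i else w, fun i j hij hj => ?_⟩
    have hin : i < n := by omega
    rcases (Nat.lt_succ_iff.1 hj).lt_or_eq with hjn | rfl
    · simpa [hin, hjn] using hz i j hij hjn
    · simp only [hin, if_true, lt_irrefl, if_false]
      exact ⟨hlo _ (.inl ⟨i, hin, rfl⟩), fun h => hhi _ ⟨i, ⟨hin, h⟩, rfl⟩,
        fun h => hlo _ (.inr ⟨i, ⟨hin, h⟩, rfl⟩)⟩

lemma unit_intervals_meet_iff (x y : ℝ) :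
    (Set.Icc x (x + 1) ∩ Set.Icc y (y + 1)).Nonempty ↔ x ≤ y + 1 ∧ y ≤ x + 1 := by
  simp only [Set.Icc_inter_Icc, Set.nonempty_Icc, sup_le_iff, le_inf_iff]
  constructor
  · rintro ⟨⟨-, h1⟩, h2, -⟩
    exact ⟨h2, h1⟩
  · rintro ⟨h1, h2⟩
    refine ⟨⟨?_, ?_⟩, ?_, ?_⟩ <;> linarith

lemma isUnitIntervalGraph_meetGraph_of_monotone {n : ℕ} {y : Fin n → Triangle} (hy : Monotone y) :
    IsUnitIntervalGraph (meetGraph y) := by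
  rcases Nat.eq_zero_or_pos n with rfl | hn
  · exact ⟨0, fun v => v.elim0⟩
  -- Clamping the index extends the family monotonically to all of `ℕ`.
  let c : ℕ → Fin n := fun k => ⟨min k (n - 1), by omega⟩
  have hc : Monotone c := fun i j h => by
    simp only [c, Fin.mk_le_mk]
    omega
  have hcv : ∀ i : Fin n, c i = i := fun i => by
    ext
    simp only [c]
    omega
  obtain ⟨z, hz⟩ := exists_unit_placement (a := fun k => (y (c k)).1.1)
    (b := fun k => (y (c k)).1.2) (fun i j h => (hy (hc h)).1) (fun i j h => (hy (hc h)).2) n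
  have key : ∀ v w : Fin n, v < w → (Meets (y v) (y w) ↔
      (Set.Icc (z v) (z v + 1) ∩ Set.Icc (z w) (z w + 1)).Nonempty) := by
    intro v w hvw
    have h := hz v w hvw w.2
    simp only [hcv] at h
    rw [meets_iff, unit_intervals_meet_iff]
    have h1 : (y v).1.1 ≤ (y w).1.2 := (hy hvw.le).1.trans (y w).2.2.1
    constructor
    · exact fun hm => ⟨by linarith [h.1], (h.2.1 hm.2).le⟩
    · refine fun hm => ⟨h1, ?_⟩
      by_contra hlt
      linarith [h.2.2 (not_le.1 hlt), hm.2]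
  refine ⟨fun v => z v, fun v w hvw => ?_⟩
  simp only [meetGraph, ne_eq, hvw, not_false_eq_true, true_and]
  rcases lt_or_gt_of_ne hvw with h | h
  · exact key v w h
  · rw [meets_comm, Set.inter_comm]
    exact key w v h

/-- On a chain, the coordinate sum determines the product order, so sorting by the sum reduces to
the monotone case; being a unit interval graph does not depend on the labelling. -/
lemma isUnitIntervalGraph_meetGraph {n : ℕ} {x : Fin n → Triangle}
    (hx : ∀ i j, x i ≤ x j ∨ x j ≤ x i) : IsUnitIntervalGraph (meetGraph x) := by
  let s : Fin n → ℝ := fun i => (x i).1.1 + (x i).1.2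
  have hmono : Monotone (x ∘ Tuple.sort s) := by
    intro i j hij
    have hs : s (Tuple.sort s i) ≤ s (Tuple.sort s j) := Tuple.monotone_sort s hij
    rcases hx (Tuple.sort s i) (Tuple.sort s j) with h | h
    · exact h
    · have h1 : (x (Tuple.sort s j)).1.1 ≤ (x (Tuple.sort s i)).1.1 := h.1
      have h2 : (x (Tuple.sort s j)).1.2 ≤ (x (Tuple.sort s i)).1.2 := h.2
      simp only [s] at hs
      exact ⟨show (x (Tuple.sort s i)).1.1 ≤ (x (Tuple.sort s j)).1.1 by linarith,
        show (x (Tuple.sort s i)).1.2 ≤ (x (Tuple.sort s j)).1.2 by linarith⟩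
  obtain ⟨z, hz⟩ := isUnitIntervalGraph_meetGraph_of_monotone hmono
  refine ⟨fun v => z ((Tuple.sort s).symm v), fun v w hvw => ?_⟩
  rw [← hz _ _ ((Tuple.sort s).symm.injective.ne hvw)]
  simp [meetGraph]

/-! ### Measures on increasing curves give unit interval graph limits -/

/-- Sampling from `μ` yields intersection graphs of points of any given conull set that converge
to `Γ_μ`. -/
lemma exists_sample_homConverges (μ : ProbabilityMeasure Triangle) {C : Set Triangle}
    (hC : C ∈ ae (μ : Measure Triangle)) :
    ∃ (n : ℕ → ℕ) (x : ∀ m, Fin (n m) → Triangle), (∀ m i, x m i ∈ C) ∧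
      HomConverges (fun m => ⟨n m, meetGraph (x m)⟩) (measureDensity μ) := by
  classical
  have key : ∀ m : ℕ, ∃ n : ℕ, m ≤ n ∧ ∃ x : Fin n → Triangle, (∀ i, x i ∈ C) ∧
      ∀ k ≤ m, ∀ F : SimpleGraph (Fin k),
        (homDensity F (meetGraph x) - measureDensity μ k F) ^ 2 ≤ 1 / ((m : ℝ) + 1) := by
    intro m
    have hlim : Tendsto (fun n : ℕ => ∑ k ∈ Finset.range (m + 1),
        ∑ _F : SimpleGraph (Fin k), (nonInj (k + k) n + 2 * nonInj k n)) atTop (𝓝 0) := by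
      have : (0 : ℝ) = ∑ k ∈ Finset.range (m + 1),
          ∑ _F : SimpleGraph (Fin k), ((0 : ℝ) + 2 * 0) := by simp
      rw [this]
      exact tendsto_finsetSum _ fun k _ => tendsto_finsetSum _ fun F _ =>
        (tendsto_nonInj _).add ((tendsto_nonInj _).const_mul 2)
    have hev := hlim.eventually (ge_mem_nhds (show (0 : ℝ) < 1 / ((m : ℝ) + 1) by positivity))
    obtain ⟨n, hn, hmn, hn0⟩ :=
      (hev.and ((eventually_ge_atTop m).and (eventually_gt_atTop 0))).exists
    have hsm := fun (k : ℕ) (F : SimpleGraph (Fin k)) => second_moment μ hn0 F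
    have hI : Integrable (fun x : Fin n → Triangle => ∑ k ∈ Finset.range (m + 1),
        ∑ F : SimpleGraph (Fin k), (homDensity F (meetGraph x) - measureDensity μ k F) ^ 2)
        (Measure.pi fun _ => (μ : Measure Triangle)) :=
      integrable_finsetSum _ fun k _ => integrable_finsetSum _ fun F _ => (hsm k F).1
    have hae : ∀ᵐ x : Fin n → Triangle ∂(Measure.pi fun _ => (μ : Measure Triangle)),
        ∀ i, x i ∈ C := ae_all_iff.2 fun i =>
      (measurePreserving_eval (fun _ : Fin n => (μ : Measure Triangle)) i).quasiMeasurePreserving.ae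
        hC
    -- Some point outside a given null set is still at most the mean, so one sample has all its
    -- points in `C` and small total squared error.
    obtain ⟨x, hxC, hx⟩ := exists_notMem_null_le_integral hI (ae_iff.1 hae)
    simp only [Set.mem_ofPred_eq, not_not] at hxC
    rw [integral_finsetSum _ fun k _ => integrable_finsetSum _ fun F _ => (hsm k F).1] at hx
    simp only [integral_finsetSum _ fun F _ => (hsm _ F).1] at hx
    have hx2 := hx.trans ((Finset.sum_le_sum fun k _ => Finset.sum_le_sum fun F _ =>
      (hsm k F).2).trans hn)
    refine ⟨n, hmn, x, hxC, fun k hk F => le_trans ?_ hx2⟩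
    refine le_trans ?_ (Finset.single_le_sum (f := fun k => ∑ F : SimpleGraph (Fin k),
      (homDensity F (meetGraph x) - measureDensity μ k F) ^ 2)
      (fun k _ => Finset.sum_nonneg fun F _ => sq_nonneg _)
      (Finset.mem_range.2 (Nat.lt_succ_of_le hk)))
    exact Finset.single_le_sum (f := fun F : SimpleGraph (Fin k) =>
      (homDensity F (meetGraph x) - measureDensity μ k F) ^ 2)
      (fun F _ => sq_nonneg _) (Finset.mem_univ F)
  choose n hn x hxC hx using key
  refine ⟨n, x, hxC, tendsto_atTop_mono hn tendsto_id, fun k F => ?_⟩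
  rw [← tendsto_sub_nhds_zero_iff]
  have hsq : Tendsto (fun m => (homDensity F (meetGraph (x m)) - measureDensity μ k F) ^ 2)
      atTop (𝓝 0) := by
    refine tendsto_of_tendsto_of_tendsto_of_le_of_le' tendsto_const_nhds
      tendsto_one_div_add_atTop_nhds_zero_nat (Eventually.of_forall fun m => sq_nonneg _) ?_
    filter_upwards [eventually_ge_atTop k] with m hm using hx m k hm F
  have := hsq.sqrt
  simp only [Real.sqrt_sq_eq_abs, Real.sqrt_zero] at this
  exact (tendsto_zero_iff_abs_tendsto_zero _).2 this

lemma isUnitIntervalGraphLimit_ofMeasure {μ : ProbabilityMeasure Triangle}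
    (hμ : HasIncreasingCurveSupport μ) : (GraphLimit.ofMeasure μ).IsUnitIntervalGraphLimit := by
  obtain ⟨γ, -, h1, h2, hsupp⟩ := hμ
  obtain ⟨n, x, hx, hconv⟩ := exists_sample_homConverges μ
    (mem_of_superset Measure.support_mem_ae hsupp)
  refine ⟨_, fun m => isUnitIntervalGraph_meetGraph fun i j => ?_, hconv⟩
  obtain ⟨s, hs⟩ := hx m i
  obtain ⟨t, ht⟩ := hx m j
  rw [← hs, ← ht]
  exact (le_total s t).imp (fun h => ⟨h1 h, h2 h⟩) fun h => ⟨h1 h, h2 h⟩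


/-! ### Increasing curves through graphs of monotone functions -/

/-- The interval `[u, r u]`. -/
def graphPoint {r : unitInterval → unitInterval} (hr : ∀ u, u ≤ r u) (u : unitInterval) :
    Triangle :=
  ⟨(u, r u), u.2.1, hr u, (r u).2.2⟩

/-- The first coordinate of the point with coordinate sum `s` on the completed graph of `r`. -/
def completedGraphFst (r : unitInterval → unitInterval) (s : ℝ) : ℝ :=
  -- The value `0` keeps the set nonempty when `s < r 0`; it produces the vertical segment from `(0,
  -- 0)` up to the graph.
  sSup {w : ℝ | w = 0 ∨ ∃ u : unitInterval, (u : ℝ) = w ∧ (u : ℝ) + r u ≤ s}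

section completedGraph

variable {r : unitInterval → unitInterval}

lemma le_completedGraphFst {s : ℝ} {u : unitInterval} (h : (u : ℝ) + r u ≤ s) :
    (u : ℝ) ≤ completedGraphFst r s := by
  refine le_csSup ⟨1, ?_⟩ (.inr ⟨u, rfl, h⟩)
  rintro w (rfl | ⟨u, rfl, -⟩)
  exacts [zero_le_one, u.2.2]

lemma completedGraphFst_le {s c : ℝ} (hc : 0 ≤ c)
    (h : ∀ u : unitInterval, (u : ℝ) + r u ≤ s → (u : ℝ) ≤ c) : completedGraphFst r s ≤ c := by
  refine csSup_le ⟨0, .inl rfl⟩ ?_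
  rintro w (rfl | ⟨u, rfl, hu⟩)
  exacts [hc, h u hu]

lemma completedGraphFst_nonneg (s : ℝ) : 0 ≤ completedGraphFst r s := by
  refine le_csSup ⟨1, ?_⟩ (.inl rfl)
  rintro w (rfl | ⟨u, rfl, -⟩)
  exacts [zero_le_one, u.2.2]

lemma completedGraphFst_mono : Monotone (completedGraphFst r) := fun _ _ hst =>
  completedGraphFst_le (completedGraphFst_nonneg _) fun _ hu => le_completedGraphFst (hu.trans hst)

/-- Moving `u` left by `t - s` lowers `u + r u` by at least `t - s`, because `r` is monotone. The
bound gives both continuity of the curve and monotonicity of its second coordinate. -/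
lemma completedGraphFst_le_add (hr : Monotone r) {s t : ℝ} (hst : s ≤ t) :
    completedGraphFst r t ≤ completedGraphFst r s + (t - s) := by
  have h0 := completedGraphFst_nonneg (r := r) s
  refine completedGraphFst_le (by linarith) fun u hu => ?_
  rcases le_total (u : ℝ) (t - s) with h | h
  · linarith
  · let u' : unitInterval := ⟨u - (t - s), by linarith, by linarith [u.2.2]⟩
    have hle : u' ≤ u := Subtype.coe_le_coe.1 (show (u : ℝ) - (t - s) ≤ u by linarith)
    have h1 : (r u' : ℝ) ≤ r u := hr hle
    have h2 : (u' : ℝ) = u - (t - s) := rfl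
    have := le_completedGraphFst (r := r) (s := s) (u := u') (by linarith)
    linarith

/-- Since `u + r u` is strictly increasing, a point of the graph is recovered from its coordinate
sum; hence the graph lies on the curve. -/
lemma completedGraphFst_add (hr : Monotone r) (u : unitInterval) :
    completedGraphFst r (u + r u) = u := by
  refine le_antisymm (completedGraphFst_le u.2.1 fun w hw => ?_) (le_completedGraphFst le_rfl)
  by_contra! h
  have h1 : (r u : ℝ) ≤ r w := hr (Subtype.coe_le_coe.1 h.le)
  linarith

lemma two_mul_completedGraphFst_le (hr : ∀ u, u ≤ r u) {s : ℝ} (hs : 0 ≤ s) :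
    2 * completedGraphFst r s ≤ s := by
  have : completedGraphFst r s ≤ s / 2 := completedGraphFst_le (by linarith) fun u hu => by
    have : (u : ℝ) ≤ r u := hr u
    linarith
  linarith

/-- For `s ≥ 1` the point `u = s - 1` is admissible because `r u ≤ 1`. This keeps the second
coordinate of the curve at most `1`. -/
lemma sub_one_le_completedGraphFst {s : ℝ} (hs : s ≤ 2) : s - 1 ≤ completedGraphFst r s := by
  rcases le_total s 1 with h | h
  · linarith [completedGraphFst_nonneg (r := r) s]
  · let u : unitInterval := ⟨s - 1, by linarith, by linarith⟩
    have hu : (u : ℝ) = s - 1 := rfl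
    have := le_completedGraphFst (r := r) (s := s) (u := u) (by linarith [(r u).2.2])
    linarith

lemma continuous_completedGraphFst (hr : Monotone r) : Continuous (completedGraphFst r) := by
  refine (LipschitzWith.of_dist_le_mul (K := 1) fun s t => ?_).continuous
  rw [NNReal.coe_one, one_mul, Real.dist_eq, Real.dist_eq]
  rcases le_total s t with h | h
  · rw [abs_sub_comm, abs_sub_comm s, abs_of_nonneg (sub_nonneg.2 h),
      abs_of_nonneg (sub_nonneg.2 (completedGraphFst_mono h))]
    linarith [completedGraphFst_le_add hr h]
  · rw [abs_of_nonneg (sub_nonneg.2 h), abs_of_nonneg (sub_nonneg.2 (completedGraphFst_mono h))]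
    linarith [completedGraphFst_le_add hr h]

end completedGraph

/-- The graph of a monotone function `r` with `u ≤ r u` lies on a continuous increasing curve. -/
lemma exists_increasing_curve {r : unitInterval → unitInterval} (hr : Monotone r)
    (hle : ∀ u, u ≤ r u) :
    ∃ γ : unitInterval → Triangle, Continuous γ ∧ Monotone (fun s => (γ s).1.1) ∧
      Monotone (fun s => (γ s).1.2) ∧ ∀ u, graphPoint hle u ∈ Set.range γ := by
  -- The curve is parametrized by coordinate sum, which ranges over `[0, 2]`; hence the factor `2`.
  let p : unitInterval → ℝ := fun s => completedGraphFst r (2 * s)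
  refine ⟨fun s => ⟨(p s, 2 * s - p s), completedGraphFst_nonneg _, ?_, ?_⟩, ?_, ?_, ?_, ?_⟩
  · have := two_mul_completedGraphFst_le hle (s := 2 * s) (by linarith [s.2.1])
    show p s ≤ 2 * s - p s
    linarith
  · have := sub_one_le_completedGraphFst (r := r) (s := 2 * s) (by linarith [s.2.2])
    show 2 * s - p s ≤ 1
    linarith
  · have hp : Continuous p := (continuous_completedGraphFst hr).comp (by fun_prop)
    exact Continuous.subtype_mk (by fun_prop) _
  · intro s t hst
    have : (s : ℝ) ≤ t := hst
    exact completedGraphFst_mono (by linarith)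
  · intro s t hst
    have h : (s : ℝ) ≤ t := hst
    have := completedGraphFst_le_add hr (s := 2 * s) (t := 2 * t) (by linarith)
    show 2 * s - p s ≤ 2 * t - p t
    linarith
  · intro u
    refine ⟨⟨(u + r u) / 2, by linarith [u.2.1, (r u).2.1], by linarith [u.2.2, (r u).2.2]⟩, ?_⟩
    have h : 2 * (((u : ℝ) + r u) / 2) = u + r u := by ring
    apply Subtype.ext
    simp only [p, h, completedGraphFst_add hr, graphPoint, add_sub_cancel_left]

lemma measurable_graphPoint {r : unitInterval → unitInterval} (hr : Monotone r)
    (hle : ∀ u, u ≤ r u) : Measurable (graphPoint hle) :=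
  Measurable.subtype_mk (measurable_subtype_coe.prodMk
    (measurable_subtype_coe.comp hr.measurable))

/-- The law of `[u, r u]`, for `u` uniform on `[0, 1]`. -/
def graphLaw {r : unitInterval → unitInterval} (hr : Monotone r) (hle : ∀ u, u ≤ r u) :
    ProbabilityMeasure Triangle :=
  ⟨volume.map (graphPoint hle),
    Measure.isProbabilityMeasure_map (measurable_graphPoint hr hle).aemeasurable⟩

/-- The curve is compact, hence closed, and a closed set of full measure contains the support. -/
lemma hasIncreasingCurveSupport_graphLaw {r : unitInterval → unitInterval} (hr : Monotone r)
    (hle : ∀ u, u ≤ r u) : HasIncreasingCurveSupport (graphLaw hr hle) := by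
  obtain ⟨γ, hγ, h1, h2, hmem⟩ := exists_increasing_curve hr hle
  have hcl : IsClosed (Set.range γ) := (isCompact_range hγ).isClosed
  refine ⟨γ, hγ, h1, h2, Measure.support_subset_of_isClosed hcl ?_⟩
  exact (ae_map_iff (measurable_graphPoint hr hle).aemeasurable hcl.measurableSet).2
    (Eventually.of_forall hmem)

lemma measureDensity_graphLaw {r : unitInterval → unitInterval} (hr : Monotone r)
    (hle : ∀ u, u ≤ r u) (k : ℕ) (F : SimpleGraph (Fin k)) :
    measureDensity (graphLaw hr hle) k F =
      ∫ u : Fin k → unitInterval,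
        {u | (fun i => graphPoint hle (u i)) ∈ homSet F}.indicator (fun _ => (1 : ℝ)) u := by
  have hm := measurable_graphPoint hr hle
  have hpi : (Measure.pi fun _ : Fin k => (graphLaw hr hle : Measure Triangle)) =
      (volume : Measure (Fin k → unitInterval)).map fun u i => graphPoint hle (u i) := by
    have : IsProbabilityMeasure ((volume : Measure unitInterval).map (graphPoint hle)) :=
      Measure.isProbabilityMeasure_map hm.aemeasurable
    rw [volume_pi, Measure.pi_map_pi fun _ => hm.aemeasurable]
    rfl
  have hmk : Measurable fun (u : Fin k → unitInterval) i => graphPoint hle (u i) :=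
    measurable_pi_lambda _ fun i => hm.comp (measurable_pi_apply i)
  rw [measureDensity_eq, hpi, integral_map hmk.aemeasurable
    (aestronglyMeasurable_const.indicator (measurableSet_homSet F))]
  rfl

/-! ### Helly selection -/

/-- A sequence of monotone functions on the unit interval has a subsequence that converges at the
interior continuity points of a monotone function. -/
lemma exists_subseq_tendsto_of_monotone {f : ℕ → unitInterval → unitInterval}
    (hf : ∀ m, Monotone (f m)) :
    ∃ (φ : ℕ → ℕ) (r : unitInterval → unitInterval), StrictMono φ ∧ Monotone r ∧
      (∀ u, (∀ m, u ≤ f m u) → u ≤ r u) ∧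
      ∀ u, 0 < u → u < 1 → ContinuousAt r u →
        Tendsto (fun m => f (φ m) u) atTop (𝓝 (r u)) := by
  obtain ⟨D, hDc, hD⟩ := TopologicalSpace.exists_countable_dense unitInterval
  have : Countable D := hDc.to_subtype
  -- Compactness of the countable product of copies of `[0, 1]` replaces a diagonal argument.
  obtain ⟨L, φ, hφ, hL⟩ := CompactSpace.tendsto_subseq fun m (q : D) => f m q
  rw [tendsto_pi_nhds] at hL
  -- The lower limit exists everywhere, agrees with the limit on `D`, and inherits monotonicity and
  -- the bound `u ≤ f m u`.
  let r : unitInterval → unitInterval := fun u => liminf (fun m => f (φ m) u) atTop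
  have hrD : ∀ q ∈ D, Tendsto (fun m => f (φ m) q) atTop (𝓝 (r q)) := by
    intro q hq
    have h := hL ⟨q, hq⟩
    have h2 : r q = L ⟨q, hq⟩ := h.liminf_eq
    rw [h2]
    exact h
  refine ⟨φ, r, hφ, ?_, ?_, ?_⟩
  · exact fun u v huv => liminf_le_liminf (Eventually.of_forall fun m => hf (φ m) huv)
  · exact fun u hu => le_liminf_of_le (by isBoundedDefault) (Eventually.of_forall fun m => hu _)
  · intro u h0 h1 hc
    refine tendsto_order.2 ⟨fun a ha => ?_, fun a ha => ?_⟩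
    -- A point of `D` slightly to the left of `u` bounds `f (φ m) u` from below; the other case uses
    -- one to the right.
    · obtain ⟨l, hl, hlu⟩ := exists_Ioc_subset_of_mem_nhds (hc (Ioi_mem_nhds ha)) ⟨0, h0⟩
      obtain ⟨q, hq, hqD⟩ := hD.exists_between hl
      filter_upwards [(hrD q hq).eventually (Ioi_mem_nhds (hlu ⟨hqD.1, hqD.2.le⟩))] with m hm
      exact lt_of_lt_of_le hm (hf _ hqD.2.le)
    · obtain ⟨l, hl, hlu⟩ := exists_Ico_subset_of_mem_nhds (hc (Iio_mem_nhds ha)) ⟨1, h1⟩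
      obtain ⟨q, hq, hqD⟩ := hD.exists_between hl
      filter_upwards [(hrD q hq).eventually (Iio_mem_nhds (hlu ⟨hqD.1.le, hqD.2⟩))] with m hm
      exact lt_of_le_of_lt (hf _ hqD.1.le) hm


/-! ### Homomorphism densities as integrals over uniform variables -/

/-- The map `v` pushes Lebesgue measure to the uniform law on vertices, so independent uniform
variables yield a uniformly random map. All graphs of a sequence thus live on one probability space.
-/
lemma homDensity_eq_integral {k n : ℕ} (F : SimpleGraph (Fin k)) (G : SimpleGraph (Fin n))
    {v : unitInterval → Fin n} (hv : Measurable v)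
    (hvol : ∀ i, volume (v ⁻¹' {i}) = (n : ENNReal)⁻¹) :
    homDensity F G = ∫ u : Fin k → unitInterval,
      {u | ∀ i j, F.Adj i j → G.Adj (v (u i)) (v (u j))}.indicator (fun _ => (1 : ℝ)) u := by
  classical
  let A : Set (Fin k → Fin n) := {f | ∀ i j, F.Adj i j → G.Adj (f i) (f j)}
  have : IsProbabilityMeasure ((volume : Measure unitInterval).map v) :=
    Measure.isProbabilityMeasure_map hv.aemeasurable
  have hpi : (volume : Measure (Fin k → unitInterval)).map (fun u i => v (u i)) =
      Measure.pi fun _ => (volume : Measure unitInterval).map v := by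
    rw [volume_pi, Measure.pi_map_pi fun _ => hv.aemeasurable]
  have hvk : Measurable fun (u : Fin k → unitInterval) i => v (u i) :=
    measurable_pi_lambda _ fun i => hv.comp (measurable_pi_apply i)
  have h1 : ∫ u : Fin k → unitInterval,
      {u | ∀ i j, F.Adj i j → G.Adj (v (u i)) (v (u j))}.indicator (fun _ => (1 : ℝ)) u =
      ∫ f, A.indicator (fun _ => (1 : ℝ)) f
        ∂(Measure.pi fun _ => (volume : Measure unitInterval).map v) := by
    rw [← hpi, integral_map hvk.aemeasurable
      (aestronglyMeasurable_const.indicator A.toFinite.measurableSet)]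
    rfl
  have hsing : ∀ f : Fin k → Fin n,
      (Measure.pi fun _ => (volume : Measure unitInterval).map v).real {f} = ((n : ℝ) ^ k)⁻¹ := by
    intro f
    rw [measureReal_def, ← Set.univ_pi_singleton, Measure.pi_pi]
    simp [Measure.map_apply hv, hvol, inv_pow]
  have e : (F →g G) ≃ A :=
    { toFun := fun f => ⟨f, fun i j h => f.map_adj h⟩
      invFun := fun f => ⟨f.1, fun {i j} h => f.2 i j h⟩
      left_inv := fun f => rfl
      right_inv := fun f => rfl }
  rw [h1, integral_fintype (Integrable.of_finite), homDensity, Nat.card_congr e]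
  simp only [hsing, Set.indicator_apply, smul_eq_mul, mul_ite, mul_one, mul_zero]
  rw [← Finset.sum_filter, Finset.sum_const, nsmul_eq_mul, div_eq_mul_inv,
    Nat.card_eq_fintype_card, Fintype.card_subtype]

/-! ### Unit interval graphs as step functions -/

/-- The index of the cell of the partition of `[0, 1]` into `n` equal intervals containing `u`. -/
def cell {n : ℕ} (hn : 0 < n) (u : unitInterval) : Fin n :=
  -- The minimum takes effect only at `u = 1`, where the floor would be `n`.
  ⟨min ⌊n * (u : ℝ)⌋₊ (n - 1), by omega⟩

section cell

variable {n : ℕ} (hn : 0 < n)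

lemma cell_mono : Monotone (cell hn) := fun u w h => by
  have h' : (u : ℝ) ≤ w := h
  exact min_le_min_right _ (Nat.floor_mono (by gcongr))

lemma coe_cell_of_lt_one {u : unitInterval} (hu : u < 1) :
    (cell hn u : ℕ) = ⌊n * (u : ℝ)⌋₊ := by
  have hu' : (u : ℝ) < 1 := hu
  have hn' : (0 : ℝ) < n := by exact_mod_cast hn
  have : ⌊n * (u : ℝ)⌋₊ < n := (Nat.floor_lt (mul_nonneg hn'.le u.2.1)).2 (by nlinarith)
  simp only [cell]
  omega

lemma le_coe_cell_add_one (u : unitInterval) : n * (u : ℝ) ≤ (cell hn u : ℕ) + 1 := by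
  rcases eq_or_lt_of_le u.2.2 with h | h
  · have : (cell hn u : ℕ) + 1 = n := by
      simp only [cell, h, mul_one, Nat.floor_natCast]
      omega
    rw [h, mul_one]
    exact_mod_cast this.ge
  · rw [coe_cell_of_lt_one hn h]
    exact (Nat.lt_floor_add_one _).le

lemma volume_cell_preimage (i : Fin n) : volume (cell hn ⁻¹' {i}) = (n : ENNReal)⁻¹ := by
  have hn' : (0 : ℝ) < n := by exact_mod_cast hn
  have hi : ((i : ℕ) : ℝ) + 1 ≤ n := by exact_mod_cast i.2
  let a : unitInterval := ⟨(i : ℕ) / n, by positivity, (div_le_one hn').2 (by linarith)⟩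
  let b : unitInterval := ⟨((i : ℕ) + 1) / n, by positivity, (div_le_one hn').2 hi⟩
  have hae : cell hn ⁻¹' {i} =ᵐ[volume] Set.Ico a b := by
    filter_upwards [compl_mem_ae_iff.2 (measure_singleton (1 : unitInterval))] with u hu
    have hu1 : u < 1 := lt_of_le_of_ne u.2.2 hu
    refine propext ?_
    show cell hn u = i ↔ a ≤ u ∧ u < b
    rw [Fin.ext_iff, coe_cell_of_lt_one hn hu1, Nat.floor_eq_iff (mul_nonneg hn'.le u.2.1),
      ← Subtype.coe_le_coe, ← Subtype.coe_lt_coe, div_le_iff₀ hn', lt_div_iff₀ hn', mul_comm]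
  rw [measure_congr hae, unitInterval.volume_Ico]
  have : (b : ℝ) - a = (n : ℝ)⁻¹ := by
    simp only [a, b]
    ring
  rw [this, ENNReal.ofReal_inv_of_pos hn', ENNReal.ofReal_natCast]

end cell

/-- A unit interval graph, in terms of uniform variables on `[0, 1]`: the vertices are
parametrized by intervals of equal length in such a way that the neighbours of a vertex lying to
its right form an interval whose endpoint `r` is an increasing function. -/
lemma IsUnitIntervalGraph.exists_step_representation {n : ℕ} (hn : 0 < n)
    {G : SimpleGraph (Fin n)} (hG : IsUnitIntervalGraph G) :
    ∃ (v : unitInterval → Fin n) (r : unitInterval → unitInterval), Measurable v ∧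
      (∀ i, volume (v ⁻¹' {i}) = (n : ENNReal)⁻¹) ∧ Monotone r ∧ (∀ u, u ≤ r u) ∧
      ∀ u w, u < w → w < 1 →
        (v u = v w → (n : ℝ) * (w - u) ≤ 1) ∧
        (v u ≠ v w → (G.Adj (v u) (v w) ↔ w < r u)) := by
  classical
  have hn' : (0 : ℝ) < n := by exact_mod_cast hn
  obtain ⟨x, hx⟩ := hG
  let σ := Tuple.sort x
  have hσ : Monotone (x ∘ σ) := Tuple.monotone_sort x
  let N : unitInterval → ℕ := fun u =>
    (Finset.univ.filter fun j => (x ∘ σ) j ≤ (x ∘ σ) (cell hn u) + 1).card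
  have hN : ∀ u, N u ≤ n := fun u => (Finset.card_le_univ _).trans (by simp)
  -- In sorted order the vertices within reach form an initial segment, so membership is comparison
  -- of the index with the count.
  have hlt : ∀ (u : unitInterval) (j : Fin n),
      (j : ℕ) < N u ↔ (x ∘ σ) j ≤ (x ∘ σ) (cell hn u) + 1 := fun u j =>
    Tuple.lt_card_le_iff_apply_le_of_monotone hσ
  let r : unitInterval → unitInterval := fun u =>
    ⟨N u / n, by positivity, (div_le_one hn').2 (by exact_mod_cast hN u)⟩
  have hmeas : Measurable (cell hn) := (cell_mono hn).measurable
  refine ⟨fun u => σ (cell hn u), r, (measurable_of_finite σ).comp hmeas, fun i => ?_,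
    fun u w huw => ?_, fun u => ?_, fun u w huw hw => ⟨fun h => ?_, fun h => ?_⟩⟩
  · rw [← volume_cell_preimage hn (σ.symm i)]
    congr 1
    ext u
    simp [Equiv.eq_symm_apply]
  · have hcard : N u ≤ N w := Finset.card_le_card fun j hj => by
      simp only [Finset.mem_filter, Finset.mem_univ, true_and] at hj ⊢
      linarith [hσ (cell_mono hn huw)]
    show (N u : ℝ) / n ≤ N w / n
    gcongr
  · have h1 : (cell hn u : ℕ) + 1 ≤ N u := (hlt u _).2 (by linarith)
    have h2 : (((cell hn u : ℕ) : ℝ) + 1) ≤ N u := by exact_mod_cast h1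
    show (u : ℝ) ≤ N u / n
    rw [le_div_iff₀ hn', mul_comm]
    exact (le_coe_cell_add_one hn u).trans h2
  · have h1 := le_coe_cell_add_one hn w
    rw [← σ.injective h, coe_cell_of_lt_one hn (huw.trans hw)] at h1
    have := Nat.floor_le (mul_nonneg hn'.le u.2.1)
    linarith
  · rw [hx _ _ h, unit_intervals_meet_iff]
    have hle : x (σ (cell hn u)) ≤ x (σ (cell hn w)) := hσ (cell_mono hn huw.le)
    -- As `N u` is an integer, `n * w < N u` is equivalent to the same inequality for the floor of
    -- `n * w`.
    have h2 : w < r u ↔ (cell hn w : ℕ) < N u := by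
      rw [← Subtype.coe_lt_coe, lt_div_iff₀ hn', coe_cell_of_lt_one hn hw,
        Nat.floor_lt (mul_nonneg hn'.le w.2.1), mul_comm]
    rw [h2, hlt]
    exact ⟨fun h => h.2, fun h => ⟨by linarith, h⟩⟩

/-! ### Limits of unit interval graphs -/

lemma HomConverges.comp {G : ℕ → FinGraph} {τ : (k : ℕ) → SimpleGraph (Fin k) → ℝ}
    (h : HomConverges G τ) {φ : ℕ → ℕ} (hφ : Tendsto φ atTop atTop) :
    HomConverges (fun m => G (φ m)) τ :=
  ⟨h.1.comp hφ, fun k F => (h.2 k F).comp hφ⟩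

/-- The graph of a measurable function is null because Lebesgue measure has no atoms. With `g = id`
this makes the variables distinct; with `g = r` it excludes ties at the reach. -/
lemma ae_pi_forall_ne {ι : Type*} [Fintype ι] {g : unitInterval → unitInterval}
    (hg : Measurable g) : ∀ᵐ u : ι → unitInterval, ∀ i j, i ≠ j → u j ≠ g (u i) := by
  refine ae_all_iff.2 fun i => ae_all_iff.2 fun j => ?_
  by_cases hij : i = j
  · exact Eventually.of_forall fun u h => absurd hij h
  have hind : IndepFun (fun u : ι → unitInterval => u i) (fun u => u j) volume :=
    (iIndepFun_pi (μ := fun _ : ι => (volume : Measure unitInterval)) (X := fun _ => id)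
      fun _ => aemeasurable_id).indepFun hij
  have hmap : (volume : Measure (ι → unitInterval)).map (fun u => (u i, u j)) =
      (volume : Measure unitInterval).prod volume := by
    rw [(indepFun_iff_map_prod_eq_prod_map_map (measurable_pi_apply i).aemeasurable
      (measurable_pi_apply j).aemeasurable).1 hind]
    exact congrArg₂ Measure.prod
      (measurePreserving_eval (fun _ : ι => (volume : Measure unitInterval)) i).map_eq
      (measurePreserving_eval (fun _ : ι => (volume : Measure unitInterval)) j).map_eq
  have hS : MeasurableSet {p : unitInterval × unitInterval | p.2 = g p.1} :=
    measurableSet_eq_fun measurable_snd (hg.comp measurable_fst)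
  have hnull : ((volume : Measure unitInterval).prod volume)
      {p : unitInterval × unitInterval | p.2 = g p.1} = 0 :=
    (Measure.measure_prod_null hS).2 (Eventually.of_forall fun a =>
      measure_singleton (g a))
  rw [← hmap, Measure.map_apply ((measurable_pi_apply i).prodMk (measurable_pi_apply j)) hS]
    at hnull
  filter_upwards [compl_mem_ae_iff.2 hnull] with u hu _ using hu

lemma meets_graphPoint_iff {r : unitInterval → unitInterval} (hle : ∀ u, u ≤ r u)
    {u w : unitInterval} (h : u ≤ w) :
    Meets (graphPoint hle u) (graphPoint hle w) ↔ w ≤ r u := by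
  rw [meets_iff]
  exact ⟨fun h => h.2, fun h' => ⟨h.trans (hle w), h'⟩⟩

lemma tendsto_homDensity_of_step {G : ℕ → FinGraph} (hG : Tendsto (fun m => (G m).1) atTop atTop)
    {v : ∀ m, unitInterval → Fin (G m).1} {f : ℕ → unitInterval → unitInterval}
    (hv : ∀ m, Measurable (v m)) (hvol : ∀ m i, volume (v m ⁻¹' {i}) = ((G m).1 : ENNReal)⁻¹)
    (hadj : ∀ m u w, u < w → w < 1 →
        (v m u = v m w → ((G m).1 : ℝ) * (w - u) ≤ 1) ∧
        (v m u ≠ v m w → ((G m).2.Adj (v m u) (v m w) ↔ w < f m u)))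
    {r : unitInterval → unitInterval} (hr : Monotone r) (hle : ∀ u, u ≤ r u)
    (hf : ∀ u, 0 < u → u < 1 → ContinuousAt r u → Tendsto (fun m => f m u) atTop (𝓝 (r u)))
    (k : ℕ) (F : SimpleGraph (Fin k)) :
    Tendsto (fun m => homDensity F (G m).2) atTop (𝓝 (measureDensity (graphLaw hr hle) k F)) := by
  -- Away from the tie `w = r u`, the strict test `w < f m u` eventually agrees with the closed test
  -- `w ≤ r u`. Since the cells shrink, `u` and `w` eventually represent different vertices.
  have hpair : ∀ u w, 0 < u → u < w → w < 1 → ContinuousAt r u → w ≠ r u →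
      ∀ᶠ m in atTop, ((G m).2.Adj (v m u) (v m w) ↔
        Meets (graphPoint hle u) (graphPoint hle w)) := by
    intro u w h0 huw hw hc hne
    have hd : (0 : ℝ) < w - u := sub_pos.2 huw
    have hlarge : ∀ᶠ m in atTop, 1 < ((G m).1 : ℝ) * (w - u) :=
      ((tendsto_natCast_atTop_atTop.comp hG).atTop_mul_const hd).eventually_gt_atTop 1
    have hlim := hf u h0 (huw.trans hw) hc
    have hcmp : ∀ᶠ m in atTop, (w < f m u ↔ w ≤ r u) := by
      rcases lt_or_gt_of_ne hne with h | h
      · filter_upwards [hlim.eventually (Ioi_mem_nhds h)] with m hm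
        exact iff_of_true hm h.le
      · filter_upwards [hlim.eventually (Iio_mem_nhds h)] with m hm
        exact iff_of_false (not_lt.2 (le_of_lt hm)) (not_le.2 h)
    filter_upwards [hlarge, hcmp] with m hm1 hm2
    have h := hadj m u w huw hw
    rw [meets_graphPoint_iff hle huw.le, ← hm2]
    exact h.2 fun he => absurd (h.1 he) (not_le.2 hm1)
  -- A monotone function has only countably many discontinuities.
  have hae1 : ∀ᵐ u : unitInterval, 0 < u ∧ u < 1 ∧ ContinuousAt r u := by
    filter_upwards [hr.countable_not_continuousAt.ae_notMem volume,
      compl_mem_ae_iff.2 (measure_singleton (0 : unitInterval)),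
      compl_mem_ae_iff.2 (measure_singleton (1 : unitInterval))] with u h1 h2 h3
    exact ⟨lt_of_le_of_ne u.2.1 (Ne.symm h2), lt_of_le_of_ne u.2.2 h3, not_not.1 h1⟩
  have hae : ∀ᵐ u : Fin k → unitInterval, ∀ i, 0 < u i ∧ u i < 1 ∧ ContinuousAt r (u i) :=
    ae_all_iff.2 fun i => (measurePreserving_eval (fun _ : Fin k => (volume : Measure
      unitInterval)) i).quasiMeasurePreserving.ae hae1
  rw [measureDensity_graphLaw]
  simp only [fun m => homDensity_eq_integral F (G m).2 (hv m) (hvol m)]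
  refine tendsto_integral_of_dominated_convergence (fun _ => 1) (fun m => ?_)
    (integrable_const _) (fun m => Eventually.of_forall fun u => ?_) ?_
  · have hvk : Measurable fun (u : Fin k → unitInterval) i => v m (u i) :=
      measurable_pi_lambda _ fun i => (hv m).comp (measurable_pi_apply i)
    exact aestronglyMeasurable_const.indicator (hvk (Set.toFinite
      {f : Fin k → Fin (G m).1 | ∀ i j, F.Adj i j → (G m).2.Adj (f i) (f j)}).measurableSet)
  · exact (norm_indicator_le_norm_self _ _).trans (by simp)
  · filter_upwards [hae, ae_pi_forall_ne measurable_id, ae_pi_forall_ne hr.measurable]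
      with u hu hdist hne
    have hev : ∀ᶠ m in atTop, ∀ i j, F.Adj i j → ((G m).2.Adj (v m (u i)) (v m (u j)) ↔
        Meets (graphPoint hle (u i)) (graphPoint hle (u j))) := by
      refine eventually_all.2 fun i => eventually_all.2 fun j => ?_
      by_cases hij : F.Adj i j
      · rcases lt_or_gt_of_ne (show u j ≠ u i from hdist i j hij.ne) with h | h
        · filter_upwards [hpair _ _ (hu j).1 h (hu i).2.1 (hu j).2.2 (hne j i hij.ne')]
            with m hm _
          rw [SimpleGraph.adj_comm, hm, meets_comm]
        · filter_upwards [hpair _ _ (hu i).1 h (hu j).2.1 (hu i).2.2 (hne i j hij.ne)]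
            with m hm _ using hm
      · exact Eventually.of_forall fun m h => absurd h hij
    refine tendsto_nhds_of_eventually_eq ?_
    filter_upwards [hev] with m hm
    refine Set.indicator_eq_indicator ?_ rfl
    exact forall₂_congr fun i j => forall_congr' (hm i j)

lemma GraphLimit.IsUnitIntervalGraphLimit.exists_measure {Γ : GraphLimit}
    (hΓ : Γ.IsUnitIntervalGraphLimit) :
    ∃ μ : ProbabilityMeasure Triangle,
      HasIncreasingCurveSupport μ ∧ Γ = GraphLimit.ofMeasure μ := by
  obtain ⟨G₀, hG₀, hconv₀⟩ := hΓ
  -- Shifting by `N` discards any empty graphs, which have no step representation.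
  obtain ⟨N, hN⟩ := eventually_atTop.1 (hconv₀.1.eventually_gt_atTop 0)
  choose v f hv hvol hf hle hadj using fun m =>
    (hG₀ (m + N)).exists_step_representation (hN _ (Nat.le_add_left N m))
  obtain ⟨φ, r, hφ, hr, hler, hlim⟩ := exists_subseq_tendsto_of_monotone hf
  have hle' : ∀ u, u ≤ r u := fun u => hler u fun m => hle m u
  have hconv := hconv₀.comp ((tendsto_add_atTop_nat N).comp hφ.tendsto_atTop)
  refine ⟨graphLaw hr hle', hasIncreasingCurveSupport_graphLaw hr hle', ?_⟩
  refine GraphLimit.ext (funext fun k => funext fun F => ?_)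
  exact tendsto_nhds_unique (hconv.2 k F) (tendsto_homDensity_of_step
    (G := fun m => G₀ (φ m + N)) hconv.1 (fun m => hv (φ m)) (fun m => hvol (φ m))
    (fun m => hadj (φ m)) hr hle' hlim k F)

end IntervalGraphLimits

end

theorem theorem10p1 (Γ : IntervalGraphLimits.GraphLimit) :
    Γ.IsUnitIntervalGraphLimit ↔
      ∃ μ : ProbabilityMeasure IntervalGraphLimits.Triangle,
        IntervalGraphLimits.HasIncreasingCurveSupport μ ∧
          Γ = IntervalGraphLimits.GraphLimit.ofMeasure μ := by
  refine ⟨fun h => h.exists_measure, ?_⟩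
  rintro ⟨μ, hμ, rfl⟩
  exact IntervalGraphLimits.isUnitIntervalGraphLimit_ofMeasure hμ
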